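/- **Conventions.** In each calculus an expression is a pair $a<b$ of formulas, and a calculus is consistent if $\top<\bot$ is not a theorem of it. $A(x)$ denotes an expression and $A(c)$ the result of replacing the free variable $x$ by the closed term $c$. Let $R$ be any family (possibly empty) of finitary relations on the positive integers, such as $\alpha+\beta=\gamma$, $\alpha\cdot\beta=\gamma$. **$Z_0$.** Numbers are $1,\,1+1,\dots$; formulas are $\top$, $\bot$, $\alpha>\beta$ and the formulas $R_i(\alpha_1,\dots,\alpha_k)$, for numbers $\alpha,\beta,\alpha_j$. Theorems are generated by: (T1) $a<b$ if "if $a$ then $b$" is true; (T2) $a<a$, $\bot<a<\top$; (T3) $a<c,\ c<b\Rightarrow a<b$. **$K_0$.** Number variables are added (also inside the atomic formulas), and formulas are closed under $\wedge,\vee,\neg,\forall_x,\exists_x$. Added rules: (T4) $a<b_1,\ a<b_2\Leftrightarrow a<b_1\wedge b_2$; (T5) $a_1<b,\ a_2<b\Leftrightarrow a_1\vee a_2<b$; (T6) $a\wedge c<b\Rightarrow a<b\vee\neg c$; (T7) $a<b\vee c\Rightarrow a\wedge\neg c<b$; (T8) $a<b(x)\Leftrightarrow a<\forall_x b(x)$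 ($x$ not free in $a$); (T9) $a(x)<b\Leftrightarrow \exists_x a(x)<b$ ($x$ not free in $b$); (T10) ($A(\alpha)$ for each number $\alpha$) $\Leftrightarrow A(x)$. **$K_0'$.** The expressions are those of $K_0$ without free variables; the theorems are generated by (T1)–(T7) and, instead of (T8)–(T10), ($a<b(\gamma)$ for each number $\gamma$) $\Leftrightarrow a<\forall_x b(x)$ and ($a(\gamma)<b$ for each number $\gamma$) $\Leftrightarrow\exists_x a(x)<b$. **Lattices.** Lattices are preordered sets. A countably complete boolean lattice is a distributive lattice in which each element has a complement and each countable subset has a meet and a join. It is *over* a bounded preordered set $M$ if $M$ is embedded in it with its preorder and its zero and unit. It is *minimal* over $M$ if no proper subset contains $M$ and is closed under complements and countable meets and joins. It is *free* over $M$ if it is minimal over $M$ and each minimal countably complete boolean lattice over $M$ is an image of it under a homomorphism (respecting complements and countable meets and joins) that fixes $M$ up to equivalence. **Ramified sets.** Types are $0$ (numbers, order $0$) and $\nu(\tau_1\dots\tau_k)$ (order $\nu$), $k\ge1$, where the $\tau_j$ are types of order $<\nu$. Let $S$ be a set of types that contains $0$ and, with each type, its argument types; for example $S=\{0\}\cup\{\nu(0):\nu\ge1\}$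 (sets of numbers), or the set of all types. Put $K_0(S)=K_0$. * $Z_{n+1}(S)$ arises from $K_n(S)$ by adding, for each formula $a(x_1,\dots,x_k)$ of $K_n(S)$ and variables $x_j$ of types $\tau_j$, pairwise distinct, with $(n+1)(\tau_1\dots\tau_k)\in S$, the set $A=\hat x_1\dots\hat x_k\,a$ of this type; the formulas $(s_1,\dots,s_k)\in A$ for terms $s_j$ of $K_n(S)$ of type $\tau_j$; the theorems $a(x_1,\dots,x_k)<(x_1,\dots,x_k)\in A$ and $(x_1,\dots,x_k)\in A<a(x_1,\dots,x_k)$; and (T2), (T3), (T10) (for all kinds of variables present) also for the new formulas. * $K_{n+1}(S)$ arises from $Z_{n+1}(S)$ by adding free and bound variables $X$ of the types of order $n+1$ in $S$, closing the formulas under membership, $\wedge,\vee,\neg$ and all quantifiers, extending (T1)–(T10) to the new formulas, and adding (T8), (T9) for the variables $X$, and the rule ($A(C)$ for each closed set $C$ of the type of $X$) $\Leftrightarrow A(X)$. * $K(S)$ is the calculus defined in the same way with all types in $S$ at once; with $S$ the set of all types it is ramified type logic including arithmetic. **Theorem.** 1. $Z_0$ is consistent. 2. For formulas $a,b$ of $K_0$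 without free variables, $a<b$ is a theorem of $K_0'$ if and only if it is a theorem of $K_0$; for formulas $a,b$ of $Z_0$, $a<b$ is a theorem of $Z_0$ if and only if it is a theorem of $K_0'$. 3. The free countably complete boolean lattice over $Z_0$ exists, and $K_0'$ is contained isomorphically in it: for every free countably complete boolean lattice $V$ over $Z_0$ there is a map $f$ from the formulas of $K_0'$ to $V$, equal up to equivalence to the given embedding on $Z_0$, such that $a<b$ is a theorem of $K_0'$ if and only if $f(a)\le f(b)$, and such that $f$ takes $\wedge,\vee,\neg$ to meet, join, complement, and $\forall_x b(x)$, $\exists_x b(x)$ to the meet and the join of $\{f(b(\gamma)):\gamma \text{ a number}\}$. 4. $K_0'$ and $K_0$ are consistent. 5. For every $S$ as above and every $n\ge0$, the calculi $Z_{n+1}(S)$ and $K_{n+1}(S)$ are consistent, and so is $K(S)$. In particular, ramified type logic including arithmetic is consistent. -/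

import Mathlib

universe u

namespace Ramified

/-! ### Countably complete boolean lattices over a preordered set

Lattices are preordered: meets and joins are determined only up to mutual `≤`. -/

/-- `d` is a complement of `c`: `c ∧ d` is below everything, `c ∨ d` is above everything. -/
def Complementary {V : Type*} [Preorder V] (c d : V) : Prop :=
  (∀ x, x ≤ c → x ≤ d → IsBot x) ∧ (∀ x, c ≤ x → d ≤ x → IsTop x)

/-- Countably complete boolean lattice. Binary meets and joins, zero and unit are the meets and
joins of pairs and of the empty set. -/
structure IsCCBooleanLattice (V : Type*) [Preorder V] : Prop where
  exists_isGLB : ∀ s : Set V, s.Countable → ∃ c, IsGLB s c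
  exists_isLUB : ∀ s : Set V, s.Countable → ∃ c, IsLUB s c
  distrib : ∀ a b c m j : V, IsGLB {a, c} m → IsLUB {b, c} j → m ≤ b → a ≤ j → a ≤ b
  exists_compl : ∀ c : V, ∃ d, Complementary c d

/-- The set `M` with the relation `r` is, via `ι`, a part of `V`, with the same zero and unit. -/
structure IsPart {M V : Type*} [Preorder V] (r : M → M → Prop) (ι : M → V) : Prop where
  le_iff : ∀ a b, r a b ↔ ι a ≤ ι b
  isBot : ∀ z, (∀ a, r z a) → IsBot (ι z)
  isTop : ∀ e, (∀ a, r a e) → IsTop (ι e)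

/-- `V` is a minimal countably complete boolean lattice over `M`: no proper subset contains `M` and
is closed under complements and countable (in particular binary) meets and joins. -/
structure IsMinimalOver {M V : Type*} [Preorder V] (r : M → M → Prop) (ι : M → V) : Prop where
  lattice : IsCCBooleanLattice V
  part : IsPart r ι
  minimal : ∀ V₀ : Set V, (∀ a, ι a ∈ V₀) →
    (∀ a c, a ∈ V₀ → Complementary a c → c ∈ V₀) →
    (∀ s c, s ⊆ V₀ → s.Countable → IsGLB s c → c ∈ V₀) →
    (∀ s c, s ⊆ V₀ → s.Countable → IsLUB s c → c ∈ V₀) → V₀ = Set.univ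

/-- A homomorphism of countably complete boolean lattices from `V` onto `V'` over `M`. -/
structure IsHomOnto {M V V' : Type*} [Preorder V] [Preorder V'] (ι : M → V) (ι' : M → V')
    (φ : V → V') : Prop where
  mono : ∀ a b, a ≤ b → φ a ≤ φ b
  map_compl : ∀ a b, Complementary a b → Complementary (φ a) (φ b)
  map_isGLB : ∀ s c, s.Countable → IsGLB s c → IsGLB (φ '' s) (φ c)
  map_isLUB : ∀ s c, s.Countable → IsLUB s c → IsLUB (φ '' s) (φ c)
  map_over : ∀ a, φ (ι a) ≤ ι' a ∧ ι' a ≤ φ (ι a)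
  onto : ∀ v', ∃ v, φ v ≤ v' ∧ v' ≤ φ v

/-- `V` is the free countably complete boolean lattice over `M`: it is minimal over `M`, and each
minimal countably complete boolean lattice over `M` is homomorphic to it over `M`. -/
structure IsFreeOver {M : Type} {V : Type u} [Preorder V] (r : M → M → Prop) (ι : M → V) :
    Prop where
  minimalOver : IsMinimalOver r ι
  hom : ∀ (V' : Type u) [Preorder V'] (ι' : M → V'), IsMinimalOver r ι' →
    ∃ φ : V → V', IsHomOnto ι ι' φ

/-! ### The calculus of numerical formulas -/

/-- Further relations between numbers (such as `α + β = γ` and `α · β = γ`) that are admitted as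
numerical formulas beside `α > β`, each with an arity and an interpretation. -/
structure NumRel where
  ι : Type
  ar : ι → ℕ
  Holds : (i : ι) → (Fin (ar i) → ℕ+) → Prop

/-- Formulas of `Z₀`. The numbers `1`, `1+1`, `1+1+1`, … are represented by `ℕ+`. -/
inductive Z0Form (N : NumRel) : Type
  | tru : Z0Form N
  | fls : Z0Form N
  | gt (α β : ℕ+) : Z0Form N
  | atom (i : N.ι) (α : Fin (N.ar i) → ℕ+) : Z0Form N

/-- The interpretation of the formulas of `Z₀`. -/
def Z0Form.Holds {N : NumRel} : Z0Form N → Prop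
  | .tru => True
  | .fls => False
  | .gt α β => α > β
  | .atom i α => N.Holds i α

/-- `Z0 a b`: the expression `a < b` is a theorem of `Z₀`. -/
inductive Z0 {N : NumRel} : Z0Form N → Z0Form N → Prop
  | t1 {a b} : (a.Holds → b.Holds) → Z0 a b
  | t2 (a) : Z0 a a
  | t2_fls (a) : Z0 .fls a
  | t2_tru (a) : Z0 a .tru
  | t3 {a b c} : Z0 a c → Z0 c b → Z0 a b

/-! ### Ramified types, terms and formulas -/

/-- Types: the type of numbers and `ν(τ₁ … τₖ)`. -/
inductive Ty : Type
  | num : Ty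
  | rel (ν : ℕ) {k : ℕ} (τ : Fin k → Ty) : Ty

def Ty.order : Ty → ℕ
  | .num => 0
  | .rel ν _ => ν

/-- In a type of order `ν`, the argument types have order less than `ν`. -/
def Ty.IsRamified : Ty → Prop
  | .num => True
  | .rel (k := k) ν τ => 0 < k ∧ ∀ i, (τ i).order < ν ∧ (τ i).IsRamified

/-- A system of ramified types: it contains the type of numbers and, with a type, its argument
types. Examples are the system of all ramified types, and the system of the types of numbers and of
sets of numbers of each order. -/
structure IsTypeSystem (S : Set Ty) : Prop where
  ramified : ∀ τ ∈ S, τ.IsRamified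
  num_mem : Ty.num ∈ S
  arg_mem : ∀ (ν k : ℕ) (τ : Fin k → Ty), Ty.rel ν τ ∈ S → ∀ i, τ i ∈ S

/-- The types of order at most `n`. -/
def upTo (S : Set Ty) (n : ℕ) : Set Ty := {τ ∈ S | τ.order ≤ n}

/-- For each type there are countably many variables. -/
abbrev Var : Type := Ty × ℕ

inductive Kind : Type
  | form : Kind
  | term (τ : Ty) : Kind

/-- Formulas and terms. The term `set ν τ x a` is the set (relation) of order `ν` of all
`x₁, …, xₖ` with `a`, where `xⱼ` is the variable `(τ j, x j)`; the formula `mem s A` says that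
`s₁, …, sₖ` is in `A`. -/
inductive Ex (N : NumRel) : Kind → Type
  | var (τ : Ty) (i : ℕ) : Ex N (.term τ)
  | num (α : ℕ+) : Ex N (.term .num)
  | set (ν : ℕ) {k : ℕ} (τ : Fin k → Ty) (x : Fin k → ℕ) (a : Ex N .form) :
      Ex N (.term (.rel ν τ))
  | tru : Ex N .form
  | fls : Ex N .form
  | gt (s t : Ex N (.term .num)) : Ex N .form
  | atom (i : N.ι) (s : Fin (N.ar i) → Ex N (.term .num)) : Ex N .form
  | mem {ν k : ℕ} {τ : Fin k → Ty} (s : ∀ j, Ex N (.term (τ j))) (A : Ex N (.term (.rel ν τ))) :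
      Ex N .form
  | and (a b : Ex N .form) : Ex N .form
  | or (a b : Ex N .form) : Ex N .form
  | not (a : Ex N .form) : Ex N .form
  | all (τ : Ty) (i : ℕ) (a : Ex N .form) : Ex N .form
  | ex (τ : Ty) (i : ℕ) (a : Ex N .form) : Ex N .form

abbrev Term (N : NumRel) (τ : Ty) : Type := Ex N (.term τ)

abbrev Form (N : NumRel) : Type := Ex N .form

def Z0Form.toForm {N : NumRel} : Z0Form N → Form N
  | .tru => .tru
  | .fls => .fls
  | .gt α β => .gt (.num α) (.num β)
  | .atom i α => .atom i fun j => .num (α j)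

/-- The variable `v` occurs free. -/
def Ex.Free {N : NumRel} (v : Var) : ∀ {κ : Kind}, Ex N κ → Prop
  | _, .var τ i => (τ, i) = v
  | _, .num _ => False
  | _, .set _ τ x a => a.Free v ∧ ∀ j, (τ j, x j) ≠ v
  | _, .tru => False
  | _, .fls => False
  | _, .gt s t => s.Free v ∨ t.Free v
  | _, .atom _ s => ∃ j, (s j).Free v
  | _, .mem s A => (∃ j, (s j).Free v) ∨ A.Free v
  | _, .and a b => a.Free v ∨ b.Free v
  | _, .or a b => a.Free v ∨ b.Free v
  | _, .not a => a.Free v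
  | _, .all τ i a => a.Free v ∧ (τ, i) ≠ v
  | _, .ex τ i a => a.Free v ∧ (τ, i) ≠ v

def Ex.Closed {N : NumRel} {κ : Kind} (e : Ex N κ) : Prop := ∀ v, ¬ e.Free v

open Classical in
/-- Replacement of the free occurrences of the variable `v` by `c`. It is used only for closed `c`,
so that no variable can be captured. -/
noncomputable def Ex.subst {N : NumRel} :
    ∀ {κ : Kind}, Ex N κ → (v : Var) → Term N v.1 → Ex N κ
  | _, .var τ i, v, c =>
      if h : v = (τ, i) then cast (congrArg (fun w : Var => Term N w.1) h) c else .var τ i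
  | _, .num α, _, _ => .num α
  | _, .set ν τ x a, v, c =>
      if ∃ j, (τ j, x j) = v then .set ν τ x a else .set ν τ x (a.subst v c)
  | _, .tru, _, _ => .tru
  | _, .fls, _, _ => .fls
  | _, .gt s t, v, c => .gt (s.subst v c) (t.subst v c)
  | _, .atom i s, v, c => .atom i fun j => (s j).subst v c
  | _, .mem s A, v, c => .mem (fun j => (s j).subst v c) (A.subst v c)
  | _, .and a b, v, c => .and (a.subst v c) (b.subst v c)
  | _, .or a b, v, c => .or (a.subst v c) (b.subst v c)
  | _, .not a, v, c => .not (a.subst v c)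
  | _, .all τ i a, v, c => if (τ, i) = v then .all τ i a else .all τ i (a.subst v c)
  | _, .ex τ i a, v, c => if (τ, i) = v then .ex τ i a else .ex τ i (a.subst v c)

/-- The expression belongs to the language over the types in `T`: its variables (free and bound)
and sets have types in `T`, and each set of order `ν` is formed from a formula of the language over
the types in `T` of order less than `ν`, by means of pairwise distinct variables. -/
def Ex.Over {N : NumRel} : ∀ {κ : Kind}, Ex N κ → Set Ty → Prop
  | _, .var τ _, T => τ ∈ T
  | _, .num _, _ => True
  | _, .set ν τ x a, T =>
      Ty.rel ν τ ∈ T ∧ (Function.Injective fun j => (τ j, x j)) ∧ a.Over {σ ∈ T | σ.order < ν}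
  | _, .tru, _ => True
  | _, .fls, _ => True
  | _, .gt s t, T => s.Over T ∧ t.Over T
  | _, .atom _ s, T => ∀ j, (s j).Over T
  | _, .mem s A, T => (∀ j, (s j).Over T) ∧ A.Over T
  | _, .and a b, T => a.Over T ∧ b.Over T
  | _, .or a b, T => a.Over T ∧ b.Over T
  | _, .not a, T => a.Over T
  | _, .all τ _ a, T => τ ∈ T ∧ a.Over T
  | _, .ex τ _ a, T => τ ∈ T ∧ a.Over T

/-! ### The calculi with variables -/

/-- `Thm T F a b`: the expression `a < b` is a theorem of the calculus whose formulas are those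
with `F`, whose variables have types in `T`, and in which the rules for the connectives and
quantifiers hold for the formulas of the language over `T`.

In `t10` the premisses range over the constants, that is the closed terms, of the type of the
variable `v`: these are the numbers for number variables, and the closed sets of type `τ` for set
variables of type `τ`. -/
inductive Thm {N : NumRel} (T : Set Ty) (F : Form N → Prop) : Form N → Form N → Prop
  | t1 {a b : Z0Form N} : (a.Holds → b.Holds) → Thm T F a.toForm b.toForm
  | t1_set_in {ν k : ℕ} {τ : Fin k → Ty} {x : Fin k → ℕ} {a : Form N} :
      F (.mem (fun j => .var (τ j) (x j)) (.set ν τ x a)) →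
      Thm T F a (.mem (fun j => .var (τ j) (x j)) (.set ν τ x a))
  | t1_set_out {ν k : ℕ} {τ : Fin k → Ty} {x : Fin k → ℕ} {a : Form N} :
      F (.mem (fun j => .var (τ j) (x j)) (.set ν τ x a)) →
      Thm T F (.mem (fun j => .var (τ j) (x j)) (.set ν τ x a)) a
  | t2 {a} : F a → Thm T F a a
  | t2_fls {a} : F a → Thm T F .fls a
  | t2_tru {a} : F a → Thm T F a .tru
  | t3 {a b c} : Thm T F a c → Thm T F c b → Thm T F a b
  | t4 {a b₁ b₂} : a.Over T → b₁.Over T → b₂.Over T →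
      Thm T F a b₁ → Thm T F a b₂ → Thm T F a (.and b₁ b₂)
  | t4_left {a b₁ b₂} : a.Over T → b₁.Over T → b₂.Over T → Thm T F a (.and b₁ b₂) → Thm T F a b₁
  | t4_right {a b₁ b₂} : a.Over T → b₁.Over T → b₂.Over T → Thm T F a (.and b₁ b₂) → Thm T F a b₂
  | t5 {a₁ a₂ b} : a₁.Over T → a₂.Over T → b.Over T →
      Thm T F a₁ b → Thm T F a₂ b → Thm T F (.or a₁ a₂) b
  | t5_left {a₁ a₂ b} : a₁.Over T → a₂.Over T → b.Over T → Thm T F (.or a₁ a₂) b → Thm T F a₁ b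
  | t5_right {a₁ a₂ b} : a₁.Over T → a₂.Over T → b.Over T → Thm T F (.or a₁ a₂) b → Thm T F a₂ b
  | t6 {a b c} : a.Over T → b.Over T → c.Over T →
      Thm T F (.and a c) b → Thm T F a (.or b (.not c))
  | t7 {a b c} : a.Over T → b.Over T → c.Over T →
      Thm T F a (.or b c) → Thm T F (.and a (.not c)) b
  | t8 {a b τ i} : τ ∈ T → a.Over T → b.Over T → ¬ a.Free (τ, i) →
      Thm T F a b → Thm T F a (.all τ i b)
  | t8_conv {a b τ i} : τ ∈ T → a.Over T → b.Over T → ¬ a.Free (τ, i) →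
      Thm T F a (.all τ i b) → Thm T F a b
  | t9 {a b τ i} : τ ∈ T → a.Over T → b.Over T → ¬ b.Free (τ, i) →
      Thm T F a b → Thm T F (.ex τ i a) b
  | t9_conv {a b τ i} : τ ∈ T → a.Over T → b.Over T → ¬ b.Free (τ, i) →
      Thm T F (.ex τ i a) b → Thm T F a b
  | t10 {a b} {v : Var} : v.1 ∈ T → F a → F b →
      (∀ c : Term N v.1, c.Closed → c.Over T → Thm T F (a.subst v c) (b.subst v c)) → Thm T F a b
  | t10_conv {a b} {v : Var} (c : Term N v.1) : v.1 ∈ T → c.Closed → c.Over T →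
      Thm T F a b → Thm T F (a.subst v c) (b.subst v c)

/-- The calculus with variables, connectives and quantifiers for all types in `T`, and with all
sets whose types are in `T`. For a type system `T` of ramified types, this is ramified type logic
including arithmetic over the types in `T`. -/
def K {N : NumRel} (T : Set Ty) : Form N → Form N → Prop := Thm T fun a => a.Over T

/-- The calculus `K₀`, arithmetic. -/
def K0 {N : NumRel} : Form N → Form N → Prop := K {Ty.num}

/-- The calculus `Kₙ` over the type system `S`. -/
def KStage {N : NumRel} (S : Set Ty) (n : ℕ) : Form N → Form N → Prop := K (upTo S n)

/-- The formulas of `Zₙ₊₁` over the type system `S`: those of `Kₙ`, and the formulas that assert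
membership in a set of order `n + 1`, formed from a formula of `Kₙ`. -/
def IsZForm {N : NumRel} (S : Set Ty) (n : ℕ) (a : Form N) : Prop :=
  a.Over (upTo S n) ∨
    ∃ (k : ℕ) (τ : Fin k → Ty) (x : Fin k → ℕ) (b : Form N) (s : ∀ j, Term N (τ j)),
      (∀ j, (s j).Over (upTo S n)) ∧ Ex.Over (.set (n + 1) τ x b : Term N _) (upTo S (n + 1)) ∧
      a = .mem s (.set (n + 1) τ x b)

/-- The calculus `Zₙ₊₁` over the type system `S`: the sets of order `n + 1` are added to `Kₙ`, but
neither connectives and quantifiers for the new formulas nor variables for the new sets. -/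
def ZStage {N : NumRel} (S : Set Ty) (n : ℕ) : Form N → Form N → Prop :=
  Thm (upTo S n) (IsZForm S n)

/-! ### The part of `K₀` without free variables -/

/-- The formulas of `K₀` without free variables. -/
def IsSentence {N : NumRel} (a : Form N) : Prop := a.Over {Ty.num} ∧ a.Closed

/-- `K0' a b`: the expression `a < b`, without free variables, is a theorem of `K₀'`, the calculus
in which the rules for variables are replaced by infinitary rules for the quantifiers. -/
inductive K0' {N : NumRel} : Form N → Form N → Prop
  | t1 {a b : Z0Form N} : (a.Holds → b.Holds) → K0' a.toForm b.toForm
  | t2 {a} : IsSentence a → K0' a a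
  | t2_fls {a} : IsSentence a → K0' .fls a
  | t2_tru {a} : IsSentence a → K0' a .tru
  | t3 {a b c} : K0' a c → K0' c b → K0' a b
  | t4 {a b₁ b₂} : K0' a b₁ → K0' a b₂ → K0' a (.and b₁ b₂)
  | t4_left {a b₁ b₂} : K0' a (.and b₁ b₂) → K0' a b₁
  | t4_right {a b₁ b₂} : K0' a (.and b₁ b₂) → K0' a b₂
  | t5 {a₁ a₂ b} : K0' a₁ b → K0' a₂ b → K0' (.or a₁ a₂) b
  | t5_left {a₁ a₂ b} : K0' (.or a₁ a₂) b → K0' a₁ b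
  | t5_right {a₁ a₂ b} : K0' (.or a₁ a₂) b → K0' a₂ b
  | t6 {a b c} : K0' (.and a c) b → K0' a (.or b (.not c))
  | t7 {a b c} : K0' a (.or b c) → K0' (.and a (.not c)) b
  | all {a b i} : IsSentence (.all .num i b) →
      (∀ γ : ℕ+, K0' a (b.subst (.num, i) (.num γ))) → K0' a (.all .num i b)
  | all_conv {a b i} (γ : ℕ+) : K0' a (.all .num i b) → K0' a (b.subst (.num, i) (.num γ))
  | ex {a b i} : IsSentence (.ex .num i a) →
      (∀ γ : ℕ+, K0' (a.subst (.num, i) (.num γ)) b) → K0' (.ex .num i a) b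
  | ex_conv {a b i} (γ : ℕ+) : K0' (.ex .num i a) b → K0' (a.subst (.num, i) (.num γ)) b

/-- `f` maps `K₀'` isomorphically into the lattice `V`, over `Z₀`: it reflects theoremhood exactly,
is the given embedding on the formulas of `Z₀`, and takes the connectives and quantifiers to the
operations of `V`. -/
structure IsIsoInto {N : NumRel} {V : Type*} [Preorder V] (ι : Z0Form N → V) (f : Form N → V) :
    Prop where
  le_iff : ∀ a b, IsSentence a → IsSentence b → (K0' a b ↔ f a ≤ f b)
  map_over : ∀ a : Z0Form N, f a.toForm ≤ ι a ∧ ι a ≤ f a.toForm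
  map_and : ∀ a b, IsSentence a → IsSentence b → IsGLB {f a, f b} (f (.and a b))
  map_or : ∀ a b, IsSentence a → IsSentence b → IsLUB {f a, f b} (f (.or a b))
  map_not : ∀ a, IsSentence a → Complementary (f a) (f (.not a))
  map_all : ∀ i b, IsSentence (.all .num i b) →
    IsGLB (Set.range fun γ : ℕ+ => f (b.subst (.num, i) (.num γ))) (f (.all .num i b))
  map_ex : ∀ i b, IsSentence (.ex .num i b) →
    IsLUB (Set.range fun γ : ℕ+ => f (b.subst (.num, i) (.num γ))) (f (.ex .num i b))

end Ramified

/-! Every calculus here is sound for a single kind of model, so consistency follows because `tru` is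
true and `fls` is false. Numbers denote themselves, and a set denotes a predicate on the full
hierarchy over the positive integers. The quantifiers, however, range only over the values of closed
terms. With these ranges the infinitary rule T10 is sound: a value that a variable may take is the
value of some closed term, so it is covered by a premiss.

The definition of the ranges looks circular, since closed terms contain quantifiers. Ramification
resolves this: a set of order ν is formed from a formula whose quantifiers have types of order less
than ν, so the range at each type depends only on the ranges at lower orders (`definable_congr`).
The result is the fixed point `range_eq`. Soundness (`Thm.sound`) is then one induction on
derivations, uniform in the type set and the formula class; no induction over the stages is needed.

For arithmetic the model is the standard one, and the infinitary rules of `K0'` decide every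
sentence: a true one is above `tru`, a false one is below `fls` (`K0'.complete`). Hence a theorem `a
< b` of `K0'` is the same as a true implication, and this is also what `K0` yields on sentences. The
numerical calculus is likewise truth of implication, so up to equivalence it has just two elements.
Every minimal lattice over it then has two elements as well (`IsMinimalOver.twoValued`), each of
them is free, and truth values give the embedding. -/

namespace Ramified

/-! ### Assignments in the full type hierarchy -/

/-- The value of a term or formula is an element of the full type hierarchy over the positive
integers, or a proposition. -/
def Ty.Dom : Ty → Type
  | .num => ℕ+
  | .rel _ τ => (∀ j, (τ j).Dom) → Prop

abbrev Kind.Dom : Kind → Type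
  | .form => Prop
  | .term τ => τ.Dom

abbrev Assignment : Type := ∀ v : Var, v.1.Dom

open Classical in
noncomputable def Assignment.set (ρ : Assignment) (v : Var) (d : v.1.Dom) : Assignment :=
  Function.update ρ v d

open Classical in
/-- Simultaneous change of the values of the variables `(τ j, x j)`. -/
noncomputable def Assignment.setAll (ρ : Assignment) {k : ℕ} (τ : Fin k → Ty) (x : Fin k → ℕ)
    (d : ∀ j, (τ j).Dom) : Assignment := fun v =>
  if h : ∃ j, (τ j, x j) = v then
    cast (congrArg (fun w : Var => w.1.Dom) h.choose_spec) (d h.choose) else ρ v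

namespace Assignment

variable (ρ : Assignment)

@[simp] theorem set_self (v : Var) (d : v.1.Dom) : ρ.set v d v = d := by simp [set]

theorem set_of_ne {v w : Var} (d : v.1.Dom) (h : w ≠ v) : ρ.set v d w = ρ w := by simp [set, h]

@[simp] theorem set_apply_self (v : Var) : ρ.set v (ρ v) = ρ := by simp [set]

theorem set_set (v : Var) (d d' : v.1.Dom) : (ρ.set v d).set v d' = ρ.set v d' := by simp [set]

open Classical in
theorem set_comm {v w : Var} (h : v ≠ w) (d : v.1.Dom) (d' : w.1.Dom) :
    (ρ.set v d).set w d' = (ρ.set w d').set v d := by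
  simp only [set]; exact Function.update_comm h _ _ _

theorem setAll_of_ne {k : ℕ} {τ : Fin k → Ty} {x : Fin k → ℕ} (d : ∀ j, (τ j).Dom) {v : Var}
    (h : ¬ ∃ j, (τ j, x j) = v) : ρ.setAll τ x d v = ρ v := by simp only [setAll, dif_neg h]

theorem setAll_congr {ρ ρ' : Assignment} {k : ℕ} {τ : Fin k → Ty} {x : Fin k → ℕ}
    (d : ∀ j, (τ j).Dom) {v : Var} (h : (¬ ∃ j, (τ j, x j) = v) → ρ v = ρ' v) :
    ρ.setAll τ x d v = ρ'.setAll τ x d v := by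
  by_cases hv : ∃ j, (τ j, x j) = v
  · simp only [setAll, dif_pos hv]
  · rw [setAll_of_ne _ _ hv, setAll_of_ne _ _ hv, h hv]

/-- This makes the comprehension axioms true. Distinctness of the variables is not needed, since
positions with the same variable receive the same value. -/
theorem setAll_self {k : ℕ} (τ : Fin k → Ty) (x : Fin k → ℕ) :
    ρ.setAll τ x (fun j => ρ (τ j, x j)) = ρ := by
  funext v
  by_cases hv : ∃ j, (τ j, x j) = v
  · simp only [setAll, dif_pos hv]
    have key : ∀ (w : Var) (h : w = v) (e : w.1.Dom = v.1.Dom), cast e (ρ w) = ρ v := by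
      rintro w rfl _; rfl
    exact key _ hv.choose_spec _
  · exact setAll_of_ne _ _ hv

theorem setAll_set_of_mem {k : ℕ} {τ : Fin k → Ty} {x : Fin k → ℕ} (d : ∀ j, (τ j).Dom) {v : Var}
    (e : v.1.Dom) (h : ∃ j, (τ j, x j) = v) : (ρ.set v e).setAll τ x d = ρ.setAll τ x d := by
  funext w
  refine setAll_congr d fun hw => set_of_ne _ _ ?_
  rintro rfl; exact hw h

theorem setAll_set_of_ne {k : ℕ} {τ : Fin k → Ty} {x : Fin k → ℕ} (d : ∀ j, (τ j).Dom) {v : Var}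
    (e : v.1.Dom) (h : ¬ ∃ j, (τ j, x j) = v) :
    (ρ.set v e).setAll τ x d = (ρ.setAll τ x d).set v e := by
  funext w
  by_cases hw : w = v
  · subst hw; rw [setAll_of_ne _ _ h, set_self, set_self]
  · rw [set_of_ne _ _ hw]; exact setAll_congr d fun _ => set_of_ne _ _ hw

end Assignment

variable {N : NumRel}

/-! ### Evaluation and substitution -/

/-- The value of a term or formula, where the quantifiers for the type `τ` range over `U τ`. -/
def Ex.eval (U : ∀ τ : Ty, Set τ.Dom) : ∀ {κ : Kind}, Ex N κ → Assignment → κ.Dom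
  | _, .var τ i, ρ => ρ (τ, i)
  | _, .num α, _ => α
  -- The arguments `d` come from the full domains; only quantifiers are restricted to `U`.
  -- Comprehension thus holds under every assignment.
  | _, .set _ τ x a, ρ => fun d => a.eval U (ρ.setAll τ x d)
  | _, .tru, _ => True
  | _, .fls, _ => False
  | _, .gt s t, ρ => (show ℕ+ from s.eval U ρ) > (show ℕ+ from t.eval U ρ)
  | _, .atom i s, ρ => N.Holds i fun j => (s j).eval U ρ
  | _, .mem s A, ρ => (A.eval U ρ : _ → Prop) fun j => (s j).eval U ρ
  | _, .and a b, ρ => (a.eval U ρ : Prop) ∧ (b.eval U ρ : Prop)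
  | _, .or a b, ρ => (a.eval U ρ : Prop) ∨ (b.eval U ρ : Prop)
  | _, .not a, ρ => ¬ (a.eval U ρ : Prop)
  | _, .all τ i a, ρ => ∀ d ∈ U τ, (a.eval U (ρ.set (τ, i) d) : Prop)
  | _, .ex τ i a, ρ => ∃ d ∈ U τ, (a.eval U (ρ.set (τ, i) d) : Prop)

/-- Truth of a formula. -/
def Ex.Sat (U : ∀ τ : Ty, Set τ.Dom) (a : Form N) (ρ : Assignment) : Prop := a.eval U ρ

theorem Ex.eval_congr (U : ∀ τ : Ty, Set τ.Dom) {κ : Kind} (e : Ex N κ) {ρ ρ' : Assignment}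
    (h : ∀ v, e.Free v → ρ v = ρ' v) : e.eval U ρ = e.eval U ρ' := by
  induction e generalizing ρ ρ' with
  | var τ i => exact h _ rfl
  | num α => rfl
  | set ν τ x a ih =>
    funext d
    refine ih fun v hv => Assignment.setAll_congr d fun hj => h v ⟨hv, fun j hj' => hj ⟨j, hj'⟩⟩
  | tru => rfl
  | fls => rfl
  | gt s t ihs iht =>
    simp only [eval, ihs fun v hv => h v (Or.inl hv), iht fun v hv => h v (Or.inr hv)]
  | atom i s ih => simp only [eval, fun j => ih j fun v hv => h v ⟨j, hv⟩]
  | mem s A ihs ihA =>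
    simp only [eval, fun j => ihs j fun v hv => h v (Or.inl ⟨j, hv⟩),
      ihA fun v hv => h v (Or.inr hv)]
  | and a b iha ihb =>
    simp only [eval, iha fun v hv => h v (Or.inl hv), ihb fun v hv => h v (Or.inr hv)]
  | or a b iha ihb =>
    simp only [eval, iha fun v hv => h v (Or.inl hv), ihb fun v hv => h v (Or.inr hv)]
  | not a ih => simp only [eval, ih fun v hv => h v hv]
  | all τ i a ih | ex τ i a ih =>
    have key : ∀ d, a.eval U (ρ.set (τ, i) d) = a.eval U (ρ'.set (τ, i) d) := by
      refine fun d => ih fun v hv => ?_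
      by_cases hw : v = (τ, i)
      · subst hw; simp
      · rw [Assignment.set_of_ne _ _ hw, Assignment.set_of_ne _ _ hw]
        exact h v ⟨hv, Ne.symm hw⟩
    simp only [eval, key]

theorem Ex.Closed.eval_eq {U : ∀ τ : Ty, Set τ.Dom} {κ : Kind} {e : Ex N κ} (h : e.Closed)
    (ρ ρ' : Assignment) : e.eval U ρ = e.eval U ρ' :=
  e.eval_congr U fun v hv => (h v hv).elim

theorem Ex.eval_set_of_not_free (U : ∀ τ : Ty, Set τ.Dom) {κ : Kind} {e : Ex N κ} {v : Var}
    (h : ¬ e.Free v) (ρ : Assignment) (d : v.1.Dom) : e.eval U (ρ.set v d) = e.eval U ρ :=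
  e.eval_congr U fun w hw => Assignment.set_of_ne _ _ (by rintro rfl; exact h hw)

/-- Under a binder the assignment changes, but the value of the closed term `c` does not. -/
theorem Ex.eval_subst (U : ∀ τ : Ty, Set τ.Dom) {κ : Kind} (e : Ex N κ) {v : Var}
    {c : Term N v.1} (hc : c.Closed) (ρ : Assignment) :
    (e.subst v c).eval U ρ = e.eval U (ρ.set v (c.eval U ρ)) := by
  induction e generalizing ρ with
  | var τ i =>
    by_cases h : v = (τ, i)
    · subst h; simp [subst, eval]
    · simp only [subst, dif_neg h, eval]; exact (Assignment.set_of_ne _ _ (Ne.symm h)).symm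
  | num α => rfl
  | set ν τ x a ih =>
    funext d
    by_cases h : ∃ j, (τ j, x j) = v
    · simp only [subst, if_pos h, eval, Assignment.setAll_set_of_mem _ _ _ h]
    · simp only [subst, if_neg h, eval, Assignment.setAll_set_of_ne _ _ _ h, ih,
        hc.eval_eq (ρ.setAll τ x d) ρ]
  | tru => rfl
  | fls => rfl
  | gt s t ihs iht => simp only [subst, eval, ihs, iht]
  | atom i s ih => simp only [subst, eval, ih]
  | mem s A ihs ihA => simp only [subst, eval, ihs, ihA]
  | and a b iha ihb => simp only [subst, eval, iha, ihb]
  | or a b iha ihb => simp only [subst, eval, iha, ihb]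
  | not a ih => simp only [subst, eval, ih]
  | all τ i a ih | ex τ i a ih =>
    by_cases h : (τ, i) = v
    · subst h; simp only [subst, if_pos, eval, Assignment.set_set]
    · have key : ∀ d, (a.subst v c).eval U (ρ.set (τ, i) d) =
          a.eval U ((ρ.set v (c.eval U ρ)).set (τ, i) d) := by
        intro d
        rw [ih, hc.eval_eq _ ρ, Assignment.set_comm ρ h]
      simp only [subst, if_neg h, eval, key]

/-- Only ranges of types that are quantified matter, and these lie in `T`. On entering a set of
order ν, `T` shrinks to its types of order less than ν. -/
theorem Ex.eval_congr_range {U U' : ∀ τ : Ty, Set τ.Dom} {κ : Kind} (e : Ex N κ) {T : Set Ty}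
    (hT : ∀ τ ∈ T, U τ = U' τ) (he : e.Over T) (ρ : Assignment) :
    e.eval U ρ = e.eval U' ρ := by
  induction e generalizing ρ T with
  | var τ i => rfl
  | num α => rfl
  | set ν τ x a ih =>
    funext d
    exact ih (fun τ hτ => hT τ hτ.1) he.2.2 _
  | tru => rfl
  | fls => rfl
  | gt s t ihs iht => simp only [eval, ihs hT he.1, iht hT he.2]
  | atom i s ih => simp only [eval, fun j => ih j hT (he j)]
  | mem s A ihs ihA => simp only [eval, fun j => ihs j hT (he.1 j), ihA hT he.2]
  | and a b iha ihb => simp only [eval, iha hT he.1, ihb hT he.2]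
  | or a b iha ihb => simp only [eval, iha hT he.1, ihb hT he.2]
  | not a ih => simp only [eval, ih hT he]
  | all τ i a ih | ex τ i a ih => simp only [eval, hT τ he.1, ih hT he.2]

/-! ### The ranges of definable objects -/

def defaultValue : ∀ τ : Ty, τ.Dom
  | .num => (1 : ℕ+)
  | .rel _ _ => fun _ => False

def defaultAssignment : Assignment := fun v => defaultValue v.1

/-- The values of the closed terms over `T`, when quantifiers range over `U`. -/
def definable (N : NumRel) (T : Set Ty) (U : ∀ τ : Ty, Set τ.Dom) (τ : Ty) : Set τ.Dom :=
  {d | ∃ c : Term N τ, c.Closed ∧ c.Over T ∧ c.eval U defaultAssignment = d}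

def rangeStage (N : NumRel) (T : Set Ty) : ℕ → ∀ τ : Ty, Set τ.Dom
  -- The starting value is immaterial: stage `n` is only used at types of order less than `n`, and
  -- there are none for `n = 0`.
  | 0 => fun _ => ∅
  | n + 1 => definable N T (rangeStage N T n)

/-- A range consisting of exactly the values of closed terms, which exists since a closed term of
order `ν` has only quantifiers of order less than `ν`. -/
def range (N : NumRel) (T : Set Ty) (τ : Ty) : Set τ.Dom := rangeStage N T (τ.order + 1) τ

/-- This is where ramification enters: a closed term is a number or a set, and the body of a set
quantifies only over types of smaller order. -/
theorem definable_congr {T : Set Ty} {U U' : ∀ τ : Ty, Set τ.Dom} {τ : Ty}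
    (h : ∀ σ : Ty, σ.order < τ.order → U σ = U' σ) : definable N T U τ = definable N T U' τ := by
  have key : ∀ c : Term N τ, c.Closed → c.Over T →
      c.eval U defaultAssignment = c.eval U' defaultAssignment := by
    intro c hc ho
    cases c with
    | var τ i => rfl
    | num α => rfl
    | set ν τ x a =>
      funext d
      exact a.eval_congr_range (fun σ hσ => h σ hσ.2) ho.2.2 _
  ext d
  constructor
  · rintro ⟨c, hc, ho, rfl⟩; exact ⟨c, hc, ho, (key c hc ho).symm⟩
  · rintro ⟨c, hc, ho, rfl⟩; exact ⟨c, hc, ho, key c hc ho⟩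

/-- The stages stabilize at a type once they pass its order, because they already agree at all lower
orders. -/
theorem rangeStage_eq (T : Set Ty) (n : ℕ) :
    ∀ τ : Ty, τ.order < n → rangeStage N T n τ = range N T τ := by
  induction n using Nat.strong_induction_on with
  | _ n ih =>
    intro τ h
    obtain ⟨m, rfl⟩ : ∃ m, n = m + 1 := ⟨n - 1, by omega⟩
    refine definable_congr fun σ hσ => ?_
    rw [ih m (by omega) σ (by omega), ih τ.order h σ hσ]

theorem range_eq (T : Set Ty) (τ : Ty) : range N T τ = definable N T (range N T) τ :=
  definable_congr fun σ hσ => rangeStage_eq T _ σ hσ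

theorem exists_closed (T : Set Ty) {τ : Ty} (h : τ ∈ T) :
    ∃ c : Term N τ, c.Closed ∧ c.Over T := by
  cases τ with
  | num => exact ⟨.num 1, fun v hv => hv, trivial⟩
  | rel ν τ =>
    -- The empty set; indexing the variables by position makes them distinct even if types repeat.
    refine ⟨.set ν τ (fun j => j) .fls, fun v hv => hv.1, h, ?_, trivial⟩
    intro i j hij
    exact Fin.ext (congrArg Prod.snd hij)

theorem range_nonempty {T : Set Ty} {τ : Ty} (h : τ ∈ T) : (range N T τ).Nonempty := by
  obtain ⟨c, hc, ho⟩ := exists_closed (N := N) T h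
  rw [range_eq]
  exact ⟨_, c, hc, ho, rfl⟩

/-! ### Soundness and consistency -/

/-- The restriction to types in `T` is essential: at a relation type outside `T` no closed term is
available and the range is empty. -/
def Admissible (N : NumRel) (T : Set Ty) (ρ : Assignment) : Prop :=
  ∀ v : Var, v.1 ∈ T → ρ v ∈ range N T v.1

theorem Admissible.set {T : Set Ty} {ρ : Assignment} (h : Admissible N T ρ) {v : Var}
    {d : v.1.Dom} (hd : d ∈ range N T v.1) : Admissible N T (ρ.set v d) := by
  intro w hw
  by_cases hv : w = v
  · subst hv; simpa using hd
  · rw [Assignment.set_of_ne _ _ hv]; exact h w hw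

theorem exists_admissible (N : NumRel) (T : Set Ty) : ∃ ρ, Admissible N T ρ := by
  classical
  refine ⟨fun v => if h : v.1 ∈ T then (range_nonempty (N := N) h).some else defaultValue _, ?_⟩
  intro v hv
  simp only [dif_pos hv]
  exact (range_nonempty (N := N) hv).some_mem

@[simp] theorem Z0Form.sat_toForm (U : ∀ τ : Ty, Set τ.Dom) (a : Z0Form N) (ρ : Assignment) :
    a.toForm.Sat U ρ ↔ a.Holds := by
  cases a <;> exact Iff.rfl

theorem Ex.sat_subst {U : ∀ τ : Ty, Set τ.Dom} (a : Form N) {v : Var}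
    {c : Term N v.1} (hc : c.Closed) (ρ : Assignment) :
    (a.subst v c).Sat U ρ ↔ a.Sat U (ρ.set v (c.eval U ρ)) :=
  iff_of_eq (a.eval_subst U hc ρ)

theorem Thm.sound {T : Set Ty} {F : Form N → Prop} {a b : Form N} (h : Thm T F a b)
    {ρ : Assignment} (hρ : Admissible N T ρ) : a.Sat (range N T) ρ → b.Sat (range N T) ρ := by
  induction h generalizing ρ with
  | t1 h => simpa using h
  | @t1_set_in ν k τ x a _ =>
    intro h
    change a.eval _ (ρ.setAll τ x fun j => ρ (τ j, x j))
    rwa [Assignment.setAll_self]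
  | @t1_set_out ν k τ x a _ =>
    intro h
    change a.eval _ (ρ.setAll τ x fun j => ρ (τ j, x j)) at h
    rwa [Assignment.setAll_self] at h
  | t2 _ => exact id
  | t2_fls _ => exact False.elim
  | t2_tru _ => exact fun _ => trivial
  | t3 _ _ ih ih' => exact fun h => ih' hρ (ih hρ h)
  | t4 _ _ _ _ _ ih ih' => exact fun h => ⟨ih hρ h, ih' hρ h⟩
  | t4_left _ _ _ _ ih => exact fun h => (ih hρ h).1
  | t4_right _ _ _ _ ih => exact fun h => (ih hρ h).2
  | t5 _ _ _ _ _ ih ih' => exact fun h => h.elim (ih hρ) (ih' hρ)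
  | t5_left _ _ _ _ ih => exact fun h => ih hρ (Or.inl h)
  | t5_right _ _ _ _ ih => exact fun h => ih hρ (Or.inr h)
  | t6 _ _ _ _ ih =>
    intro h
    by_contra hn
    exact hn (Or.inr fun hc => hn (Or.inl (ih hρ ⟨h, hc⟩)))
  | t7 _ _ _ _ ih => exact fun h => (ih hρ h.1).resolve_right h.2
  | t8 _ _ _ hf _ ih =>
    exact fun h d hd => ih (hρ.set hd) ((iff_of_eq (Ex.eval_set_of_not_free _ hf ρ d)).2 h)
  | @t8_conv a b τ i hτ _ _ _ _ ih =>
    intro h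
    have := ih hρ h (ρ (τ, i)) (hρ (τ, i) hτ)
    rwa [Assignment.set_apply_self ρ (τ, i)] at this
  | t9 _ _ _ hf _ ih =>
    rintro ⟨d, hd, h⟩
    exact (iff_of_eq (Ex.eval_set_of_not_free _ hf ρ d)).1 (ih (hρ.set hd) h)
  | @t9_conv a b τ i hτ _ _ _ _ ih =>
    intro h
    refine ih hρ ⟨ρ (τ, i), hρ (τ, i) hτ, ?_⟩
    rwa [Assignment.set_apply_self ρ (τ, i)]
  | @t10 a b v hv _ _ _ ih =>
    have hd := hρ v hv
    -- The value of `v` is that of a closed term `c`, so the premiss for `c` is the conclusion under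
    -- this assignment.
    rw [range_eq] at hd
    obtain ⟨c, hc, ho, hcd⟩ := hd
    have := ih c hc ho hρ
    rwa [Ex.sat_subst _ hc, Ex.sat_subst _ hc, hc.eval_eq ρ defaultAssignment, hcd,
      Assignment.set_apply_self] at this
  | @t10_conv a b v c _ hc ho _ ih =>
    rw [Ex.sat_subst _ hc, Ex.sat_subst _ hc]
    refine ih (hρ.set ?_)
    -- Conversely, the value of a closed term lies in the range, so the changed assignment is
    -- admissible.
    rw [range_eq]
    exact ⟨c, hc, ho, hc.eval_eq _ _⟩

theorem Thm.consistent (T : Set Ty) (F : Form N → Prop) : ¬ Thm T F .tru .fls := by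
  obtain ⟨ρ, hρ⟩ := exists_admissible N T
  exact fun h => h.sound hρ trivial

/-! ### Sentences -/

theorem Ex.subst_eq_self {κ : Kind} {e : Ex N κ} {v : Var} {c : Term N v.1} (h : ¬ e.Free v) :
    e.subst v c = e := by
  induction e with
  | var τ i =>
    have : v ≠ (τ, i) := fun hv => h hv.symm
    simp only [subst, dif_neg this]
  | num α => rfl
  | set ν τ x a ih =>
    by_cases hx : ∃ j, (τ j, x j) = v
    · simp only [subst, if_pos hx]
    · simp only [subst, if_neg hx, ih fun ha => h ⟨ha, fun j hj => hx ⟨j, hj⟩⟩]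
  | tru => rfl
  | fls => rfl
  | gt s t ihs iht =>
    simp only [subst, ihs fun hs => h (Or.inl hs), iht fun ht => h (Or.inr ht)]
  | atom i s ih => simp only [subst, fun j => ih j fun hs => h ⟨j, hs⟩]
  | mem s A ihs ihA =>
    simp only [subst, fun j => ihs j fun hs => h (Or.inl ⟨j, hs⟩), ihA fun hA => h (Or.inr hA)]
  | and a b iha ihb =>
    simp only [subst, iha fun hs => h (Or.inl hs), ihb fun ht => h (Or.inr ht)]
  | or a b iha ihb =>
    simp only [subst, iha fun hs => h (Or.inl hs), ihb fun ht => h (Or.inr ht)]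
  | not a ih => simp only [subst, ih fun ha => h ha]
  | all τ i a ih | ex τ i a ih =>
    by_cases hv : (τ, i) = v
    · simp only [subst, if_pos hv]
    · simp only [subst, if_neg hv, ih fun ha => h ⟨ha, hv⟩]

theorem Ex.Free.of_subst {κ : Kind} {e : Ex N κ} {v w : Var} {c : Term N v.1} (hc : c.Closed)
    (h : (e.subst v c).Free w) : e.Free w ∧ v ≠ w := by
  induction e with
  | var τ i =>
    by_cases hv : v = (τ, i)
    · subst hv
      simp only [subst, dite_true, cast_eq] at h
      exact (hc w h).elim
    · simp only [subst, dif_neg hv] at h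
      exact ⟨h, fun hw => hv (hw.trans (show (τ, i) = w from h).symm)⟩
  | num α => exact h.elim
  | set ν τ x a ih =>
    by_cases hx : ∃ j, (τ j, x j) = v
    · simp only [subst, if_pos hx] at h
      obtain ⟨j, rfl⟩ := hx
      exact ⟨h, h.2 j⟩
    · simp only [subst, if_neg hx] at h
      exact ⟨⟨(ih h.1).1, h.2⟩, (ih h.1).2⟩
  | tru => exact h.elim
  | fls => exact h.elim
  | gt s t ihs iht =>
    rcases h with h | h
    · exact ⟨Or.inl (ihs h).1, (ihs h).2⟩
    · exact ⟨Or.inr (iht h).1, (iht h).2⟩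
  | atom i s ih =>
    obtain ⟨j, h⟩ := h
    exact ⟨⟨j, (ih j h).1⟩, (ih j h).2⟩
  | mem s A ihs ihA =>
    rcases h with ⟨j, h⟩ | h
    · exact ⟨Or.inl ⟨j, (ihs j h).1⟩, (ihs j h).2⟩
    · exact ⟨Or.inr (ihA h).1, (ihA h).2⟩
  | and a b iha ihb | or a b iha ihb =>
    rcases h with h | h
    · exact ⟨Or.inl (iha h).1, (iha h).2⟩
    · exact ⟨Or.inr (ihb h).1, (ihb h).2⟩
  | not a ih => exact ih h
  | all τ i a ih | ex τ i a ih =>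
    by_cases hv : (τ, i) = v
    · simp only [subst, if_pos hv] at h
      exact ⟨h, hv ▸ h.2⟩
    · simp only [subst, if_neg hv] at h
      exact ⟨⟨(ih h.1).1, h.2⟩, (ih h.1).2⟩

/-- The condition on `c` is for all type sets because the type set shrinks inside set terms; numbers
satisfy it. -/
theorem Ex.Over.subst {κ : Kind} {e : Ex N κ} {v : Var} {c : Term N v.1} (hc : ∀ T, c.Over T)
    {T : Set Ty} (h : e.Over T) : (e.subst v c).Over T := by
  induction e generalizing T with
  | var τ i =>
    by_cases hv : v = (τ, i)
    · subst hv; simpa [Ex.subst] using hc T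
    · simpa only [Ex.subst, dif_neg hv] using h
  | num α => trivial
  | set ν τ x a ih =>
    by_cases hx : ∃ j, (τ j, x j) = v
    · simpa only [Ex.subst, if_pos hx] using h
    · simp only [Ex.subst, if_neg hx]
      exact ⟨h.1, h.2.1, ih h.2.2⟩
  | tru => trivial
  | fls => trivial
  | gt s t ihs iht => exact ⟨ihs h.1, iht h.2⟩
  | atom i s ih => exact fun j => ih j (h j)
  | mem s A ihs ihA => exact ⟨fun j => ihs j (h.1 j), ihA h.2⟩
  | and a b iha ihb | or a b iha ihb => exact ⟨iha h.1, ihb h.2⟩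
  | not a ih => exact ih h
  | all τ i a ih | ex τ i a ih =>
    by_cases hv : (τ, i) = v
    · simpa only [Ex.subst, if_pos hv] using h
    · simp only [Ex.subst, if_neg hv]
      exact ⟨h.1, ih h.2⟩

/-- The number of nested connectives and quantifiers outside of terms. -/
def Ex.depth : ∀ {κ : Kind}, Ex N κ → ℕ
  | _, .and a b => max a.depth b.depth + 1
  | _, .or a b => max a.depth b.depth + 1
  | _, .not a => a.depth + 1
  | _, .all _ _ a => a.depth + 1
  | _, .ex _ _ a => a.depth + 1
  | _, _ => 0

theorem Ex.depth_term {τ : Ty} (t : Term N τ) : t.depth = 0 := by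
  cases t <;> simp only [depth]

/-- An instance of a quantified formula is in general not a subexpression of it, so the completeness
proof needs a measure that substitution preserves. -/
theorem Ex.depth_subst {κ : Kind} (e : Ex N κ) {v : Var} {c : Term N v.1} :
    (e.subst v c).depth = e.depth := by
  induction e with
  | var | num | set => rw [depth_term, depth_term]
  | tru => rfl
  | fls => rfl
  | gt | atom | mem => simp only [subst, depth]
  | and a b iha ihb | or a b iha ihb => simp only [subst, depth, iha, ihb]
  | not a ih => simp only [subst, depth, ih]
  | all τ i a ih | ex τ i a ih =>
    by_cases hv : (τ, i) = v
    · simp only [subst, if_pos hv]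
    · simp only [subst, if_neg hv, depth, ih]

theorem Ex.closed_num (γ : ℕ+) : (Ex.num γ : Term N .num).Closed := fun _ h => h

theorem Ex.over_num (γ : ℕ+) (T : Set Ty) : (Ex.num γ : Term N .num).Over T := trivial

theorem Ex.Closed.eq_num {c : Term N .num} (h : c.Closed) : ∃ γ, c = .num γ := by
  cases c with
  | var τ i => exact (h _ rfl).elim
  | num γ => exact ⟨γ, rfl⟩

theorem IsSentence.and_iff {a b : Form N} :
    IsSentence (.and a b) ↔ IsSentence a ∧ IsSentence b :=
  ⟨fun h => ⟨⟨h.1.1, fun v hv => h.2 v (Or.inl hv)⟩, ⟨h.1.2, fun v hv => h.2 v (Or.inr hv)⟩⟩,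
    fun h => ⟨⟨h.1.1, h.2.1⟩, fun v hv => hv.elim (h.1.2 v) (h.2.2 v)⟩⟩

theorem IsSentence.or_iff {a b : Form N} :
    IsSentence (.or a b) ↔ IsSentence a ∧ IsSentence b :=
  ⟨fun h => ⟨⟨h.1.1, fun v hv => h.2 v (Or.inl hv)⟩, ⟨h.1.2, fun v hv => h.2 v (Or.inr hv)⟩⟩,
    fun h => ⟨⟨h.1.1, h.2.1⟩, fun v hv => hv.elim (h.1.2 v) (h.2.2 v)⟩⟩

theorem IsSentence.not_iff {a : Form N} : IsSentence (.not a) ↔ IsSentence a := Iff.rfl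

theorem IsSentence.fls : IsSentence (.fls : Form N) := ⟨trivial, fun _ h => h⟩

theorem IsSentence.tru : IsSentence (.tru : Form N) := ⟨trivial, fun _ h => h⟩

theorem IsSentence.toForm (a : Z0Form N) : IsSentence a.toForm := by
  cases a with
  | tru => exact .tru
  | fls => exact .fls
  | gt α β => exact ⟨⟨trivial, trivial⟩, fun v hv => hv.elim id id⟩
  | atom i α => exact ⟨fun _ => trivial, fun v ⟨_, hv⟩ => hv⟩

theorem IsSentence.all_inst {i : ℕ} {b : Form N} (h : IsSentence (.all .num i b)) (γ : ℕ+) :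
    IsSentence (b.subst (.num, i) (.num γ)) :=
  ⟨h.1.2.subst (v := (.num, i)) (c := .num γ) (Ex.over_num γ), fun v hv =>
    h.2 v (hv.of_subst (Ex.closed_num γ))⟩

theorem IsSentence.ex_inst {i : ℕ} {b : Form N} (h : IsSentence (.ex .num i b)) (γ : ℕ+) :
    IsSentence (b.subst (.num, i) (.num γ)) :=
  ⟨h.1.2.subst (v := (.num, i)) (c := .num γ) (Ex.over_num γ), fun v hv =>
    h.2 v (hv.of_subst (Ex.closed_num γ))⟩

/-! ### Derivations of `K0'` inside `K0` -/

theorem K0'.isSentence {a b : Form N} (h : K0' a b) : IsSentence a ∧ IsSentence b := by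
  induction h with
  | t1 _ => exact ⟨.toForm _, .toForm _⟩
  | t2 h => exact ⟨h, h⟩
  | t2_fls h => exact ⟨.fls, h⟩
  | t2_tru h => exact ⟨h, .tru⟩
  | t3 _ _ ih ih' => exact ⟨ih.1, ih'.2⟩
  | t4 _ _ ih ih' => exact ⟨ih.1, IsSentence.and_iff.2 ⟨ih.2, ih'.2⟩⟩
  | t4_left _ ih => exact ⟨ih.1, (IsSentence.and_iff.1 ih.2).1⟩
  | t4_right _ ih => exact ⟨ih.1, (IsSentence.and_iff.1 ih.2).2⟩
  | t5 _ _ ih ih' => exact ⟨IsSentence.or_iff.2 ⟨ih.1, ih'.1⟩, ih.2⟩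
  | t5_left _ ih => exact ⟨(IsSentence.or_iff.1 ih.1).1, ih.2⟩
  | t5_right _ ih => exact ⟨(IsSentence.or_iff.1 ih.1).2, ih.2⟩
  | t6 _ ih =>
    obtain ⟨ha, hc⟩ := IsSentence.and_iff.1 ih.1
    exact ⟨ha, IsSentence.or_iff.2 ⟨ih.2, hc⟩⟩
  | t7 _ ih =>
    obtain ⟨hb, hc⟩ := IsSentence.or_iff.1 ih.2
    exact ⟨IsSentence.and_iff.2 ⟨ih.1, hc⟩, hb⟩
  -- The left side is common to all premisses, so any one number would serve.
  | all h _ ih => exact ⟨(ih 1).1, h⟩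
  | all_conv γ _ ih => exact ⟨ih.1, ih.2.all_inst γ⟩
  | ex h _ ih => exact ⟨h, (ih 1).2⟩
  | ex_conv γ _ ih => exact ⟨ih.1.ex_inst γ, ih.2⟩

/-- Each infinitary quantifier rule splits into T10, which passes between the instances and a free
variable, and T8 or T9. Closed number terms are exactly the numbers. -/
theorem K0'.toK0 {a b : Form N} (h : K0' a b) : K0 a b := by
  induction h with
  | t1 h => exact .t1 h
  | t2 h => exact .t2 h.1
  | t2_fls h => exact .t2_fls h.1
  | t2_tru h => exact .t2_tru h.1
  | t3 _ _ ih ih' => exact .t3 ih ih'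
  | t4 h h' ih ih' => exact .t4 h.isSentence.1.1 h.isSentence.2.1 h'.isSentence.2.1 ih ih'
  | t4_left h ih => exact .t4_left h.isSentence.1.1 h.isSentence.2.1.1 h.isSentence.2.1.2 ih
  | t4_right h ih => exact .t4_right h.isSentence.1.1 h.isSentence.2.1.1 h.isSentence.2.1.2 ih
  | t5 h h' ih ih' => exact .t5 h.isSentence.1.1 h'.isSentence.1.1 h.isSentence.2.1 ih ih'
  | t5_left h ih => exact .t5_left h.isSentence.1.1.1 h.isSentence.1.1.2 h.isSentence.2.1 ih
  | t5_right h ih => exact .t5_right h.isSentence.1.1.1 h.isSentence.1.1.2 h.isSentence.2.1 ih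
  | t6 h ih => exact .t6 h.isSentence.1.1.1 h.isSentence.2.1 h.isSentence.1.1.2 ih
  | t7 h ih => exact .t7 h.isSentence.1.1 h.isSentence.2.1.1 h.isSentence.2.1.2 ih
  | @all a b i h h' ih =>
    have ha := (h' 1).isSentence.1
    refine .t8 rfl ha.1 h.1.2 (ha.2 _) (.t10 (v := (.num, i)) rfl ha.1 h.1.2 fun c hc _ => ?_)
    obtain ⟨γ, rfl⟩ := hc.eq_num
    rw [Ex.subst_eq_self (ha.2 _)]
    exact ih γ
  | @all_conv a b i γ h ih =>
    obtain ⟨ha, hb⟩ := h.isSentence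
    have := Thm.t10_conv (T := {Ty.num}) (v := (.num, i)) (.num γ) rfl (Ex.closed_num γ)
      (Ex.over_num γ _)
      (.t8_conv rfl ha.1 hb.1.2 (ha.2 _) ih)
    rwa [Ex.subst_eq_self (ha.2 _)] at this
  | @ex a b i h h' ih =>
    have hb := (h' 1).isSentence.2
    refine .t9 rfl h.1.2 hb.1 (hb.2 _) (.t10 (v := (.num, i)) rfl h.1.2 hb.1 fun c hc _ => ?_)
    obtain ⟨γ, rfl⟩ := hc.eq_num
    rw [Ex.subst_eq_self (hb.2 _)]
    exact ih γ
  | @ex_conv a b i γ h ih =>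
    obtain ⟨ha, hb⟩ := h.isSentence
    have := Thm.t10_conv (T := {Ty.num}) (v := (.num, i)) (.num γ) rfl (Ex.closed_num γ)
      (Ex.over_num γ _)
      (.t9_conv rfl ha.1.2 hb.1 (hb.2 _) ih)
    rwa [Ex.subst_eq_self (hb.2 _)] at this

/-! ### Truth of arithmetical sentences -/

/-- Truth in the standard model of arithmetic. -/
def IsTrue (a : Form N) : Prop := a.Sat (range N {Ty.num}) defaultAssignment

theorem range_num (T : Set Ty) : range N T .num = Set.univ :=
  Set.eq_univ_of_forall fun γ => by
    rw [range_eq]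
    exact ⟨.num γ, Ex.closed_num γ, trivial, rfl⟩

theorem IsTrue.toForm_iff (a : Z0Form N) : IsTrue a.toForm ↔ a.Holds := a.sat_toForm _ _

theorem IsTrue.and_iff {a b : Form N} : IsTrue (.and a b) ↔ IsTrue a ∧ IsTrue b := Iff.rfl

theorem IsTrue.or_iff {a b : Form N} : IsTrue (.or a b) ↔ IsTrue a ∨ IsTrue b := Iff.rfl

theorem IsTrue.not_iff {a : Form N} : IsTrue (.not a) ↔ ¬ IsTrue a := Iff.rfl

theorem IsTrue.subst_iff {i : ℕ} {b : Form N} {γ : ℕ+} :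
    IsTrue (b.subst (.num, i) (.num γ)) ↔
      b.Sat (range N {Ty.num}) (defaultAssignment.set (.num, i) γ) :=
  b.sat_subst (Ex.closed_num γ) _

theorem IsTrue.all_iff {i : ℕ} {b : Form N} :
    IsTrue (.all .num i b) ↔ ∀ γ : ℕ+, IsTrue (b.subst (.num, i) (.num γ)) := by
  simp only [subst_iff]
  change (∀ d ∈ range N {Ty.num} .num, _) ↔ _
  rw [range_num]
  exact ⟨fun h γ => h γ trivial, fun h γ _ => h γ⟩

theorem IsTrue.ex_iff {i : ℕ} {b : Form N} :
    IsTrue (.ex .num i b) ↔ ∃ γ : ℕ+, IsTrue (b.subst (.num, i) (.num γ)) := by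
  simp only [subst_iff]
  change (∃ d ∈ range N {Ty.num} .num, _) ↔ _
  rw [range_num]
  exact ⟨fun ⟨γ, _, h⟩ => ⟨γ, h⟩, fun ⟨γ, h⟩ => ⟨γ, trivial, h⟩⟩

theorem K0.isTrue {a b : Form N} (ha : IsSentence a) (hb : IsSentence b) (h : K0 a b) :
    IsTrue a → IsTrue b := by
  obtain ⟨ρ, hρ⟩ := exists_admissible N {Ty.num}
  have := h.sound hρ
  unfold IsTrue Ex.Sat at *
  rwa [ha.2.eval_eq ρ defaultAssignment, hb.2.eval_eq ρ defaultAssignment] at this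

theorem IsSentence.eq_toForm {a : Form N} (h : IsSentence a) (hd : a.depth = 0) :
    ∃ a₀ : Z0Form N, a = a₀.toForm := by
  cases a with
  | tru => exact ⟨.tru, rfl⟩
  | fls => exact ⟨.fls, rfl⟩
  | gt s t =>
    obtain ⟨α, rfl⟩ := Ex.Closed.eq_num fun v hv => h.2 v (Or.inl hv)
    obtain ⟨β, rfl⟩ := Ex.Closed.eq_num fun v hv => h.2 v (Or.inr hv)
    exact ⟨.gt α β, rfl⟩
  | atom i s =>
    choose α hα using fun j => Ex.Closed.eq_num (c := s j) fun v hv => h.2 v ⟨j, hv⟩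
    exact ⟨.atom i α, congrArg (Ex.atom i) (funext hα)⟩
  | mem s A =>
    -- Membership is excluded: neither a set variable nor a set term has its type in `{Ty.num}`.
    have hA := h.1.2
    cases A with
    | var τ i => cases hA
    | set ν τ x a => cases hA.1
  | _ => simp [Ex.depth] at hd

/-- The rules let a sentence be decided from its parts or its numerical instances; one instance
refutes a generalization, and all of them together prove it. -/
theorem K0'.complete (n : ℕ) : ∀ {a : Form N}, a.depth ≤ n → IsSentence a →
    (IsTrue a → K0' .tru a) ∧ (¬ IsTrue a → K0' a .fls) := by
  have base : ∀ a₀ : Z0Form N, (IsTrue a₀.toForm → K0' .tru a₀.toForm) ∧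
      (¬ IsTrue a₀.toForm → K0' a₀.toForm .fls) := by
    intro a₀
    rw [IsTrue.toForm_iff]
    exact ⟨fun h => .t1 (a := .tru) fun _ => h, fun h => .t1 (b := .fls) fun h' => h h'⟩
  induction n with
  | zero =>
    intro a hd ha
    obtain ⟨a₀, rfl⟩ := ha.eq_toForm (Nat.le_zero.1 hd)
    exact base a₀
  | succ n ih =>
    intro a hd ha
    cases a with
    | and a b =>
      simp only [Ex.depth] at hd
      obtain ⟨ha', hb'⟩ := IsSentence.and_iff.1 ha
      have iha := ih (a := a) (by omega) ha'
      have ihb := ih (a := b) (by omega) hb'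
      refine ⟨fun h => .t4 (iha.1 h.1) (ihb.1 h.2), fun h => ?_⟩
      by_cases h' : IsTrue a
      · exact .t3 (.t4_right (.t2 ha)) (ihb.2 fun hb => h ⟨h', hb⟩)
      · exact .t3 (.t4_left (.t2 ha)) (iha.2 h')
    | or a b =>
      simp only [Ex.depth] at hd
      obtain ⟨ha', hb'⟩ := IsSentence.or_iff.1 ha
      have iha := ih (a := a) (by omega) ha'
      have ihb := ih (a := b) (by omega) hb'
      refine ⟨fun h => ?_, fun h =>
        .t5 (iha.2 fun h' => h (Or.inl h')) (ihb.2 fun h' => h (Or.inr h'))⟩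
      rcases h with h | h
      · exact .t3 (iha.1 h) (.t5_left (.t2 ha))
      · exact .t3 (ihb.1 h) (.t5_right (.t2 ha))
    | not a =>
      simp only [Ex.depth] at hd
      have iha := ih (a := a) (by omega) ha
      have hor : IsSentence (.or .fls a) := IsSentence.or_iff.2 ⟨.fls, ha⟩
      have hor' : IsSentence (.or .fls (.not a)) := IsSentence.or_iff.2 ⟨.fls, ha⟩
      have hand : IsSentence (.and .tru a) := IsSentence.and_iff.2 ⟨.tru, ha⟩
      constructor
      · intro h
        -- From ⊤ ∧ a < a < ⊥, T6 gives ⊤ < ⊥ ∨ ¬a, and ⊥ ∨ ¬a < ¬a.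
        exact .t3 (.t6 (.t3 (.t4_right (.t2 hand)) (iha.2 h))) (.t5 (.t2_fls ha) (.t2 ha))
      · intro h
        -- Dually, ⊤ < a < ⊥ ∨ a gives ⊤ ∧ ¬a < ⊥ by T7, and ¬a < ⊤ ∧ ¬a.
        exact .t3 (.t4 (.t2_tru ha) (.t2 ha))
          (.t7 (.t3 (iha.1 (not_not.1 h)) (.t5_right (.t2 hor))))
    | all τ i b =>
      obtain rfl : τ = .num := ha.1.1
      simp only [Ex.depth] at hd
      have ihb := fun γ : ℕ+ => ih (by rw [Ex.depth_subst]; omega) (ha.all_inst γ)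
      rw [IsTrue.all_iff]
      refine ⟨fun h => .all ha fun γ => (ihb γ).1 (h γ), fun h => ?_⟩
      obtain ⟨γ, hγ⟩ := not_forall.1 h
      exact .t3 (.all_conv γ (.t2 ha)) ((ihb γ).2 hγ)
    | ex τ i b =>
      obtain rfl : τ = .num := ha.1.1
      simp only [Ex.depth] at hd
      have ihb := fun γ : ℕ+ => ih (by rw [Ex.depth_subst]; omega) (ha.ex_inst γ)
      rw [IsTrue.ex_iff]
      refine ⟨fun ⟨γ, h⟩ => .t3 ((ihb γ).1 h) (.ex_conv γ (.t2 ha)), fun h => ?_⟩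
      exact .ex ha fun γ => (ihb γ).2 fun hγ => h ⟨γ, hγ⟩
    | _ =>
      obtain ⟨a₀, h₀⟩ := ha.eq_toForm (by simp only [Ex.depth])
      have := base a₀
      rwa [← h₀] at this

theorem K0'.of_isTrue {a b : Form N} (ha : IsSentence a) (hb : IsSentence b)
    (h : IsTrue a → IsTrue b) : K0' a b := by
  by_cases h' : IsTrue a
  · exact .t3 (.t2_tru ha) ((K0'.complete _ le_rfl hb).1 (h h'))
  · exact .t3 ((K0'.complete _ le_rfl ha).2 h') (.t2_fls hb)

theorem K0'.iff_isTrue {a b : Form N} (ha : IsSentence a) (hb : IsSentence b) :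
    K0' a b ↔ (IsTrue a → IsTrue b) :=
  ⟨fun h => h.toK0.isTrue ha hb, K0'.of_isTrue ha hb⟩

theorem Z0.iff_holds {a b : Z0Form N} : Z0 a b ↔ (a.Holds → b.Holds) := by
  refine ⟨fun h => ?_, .t1⟩
  induction h with
  | t1 h => exact h
  | t2 a => exact id
  | t2_fls a => exact False.elim
  | t2_tru a => exact fun _ => trivial
  | t3 _ _ ih ih' => exact fun h => ih' (ih h)

/-! ### Two-valued lattices -/

/-- The preordered set `V` consists, up to equivalence, of a zero and a unit different from it;
the elements with `t` are the units. -/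
structure TwoValued {V : Type*} [Preorder V] (t : V → Prop) : Prop where
  le_iff : ∀ a b, a ≤ b ↔ (t a → t b)
  exists_top : ∃ a, t a
  exists_bot : ∃ a, ¬ t a

namespace TwoValued

variable {V : Type*} [Preorder V] {t : V → Prop} (ht : TwoValued t)
include ht

theorem isTop_iff {a : V} : IsTop a ↔ t a := by
  obtain ⟨e, he⟩ := ht.exists_top
  exact ⟨fun h => (ht.le_iff _ _).1 (h e) he, fun h b => (ht.le_iff _ _).2 fun _ => h⟩

theorem isBot_iff {a : V} : IsBot a ↔ ¬ t a := by
  obtain ⟨z, hz⟩ := ht.exists_bot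
  exact ⟨fun h h' => hz ((ht.le_iff _ _).1 (h z) h'),
    fun h b => (ht.le_iff _ _).2 fun h' => (h h').elim⟩

theorem isGLB_iff {s : Set V} {c : V} : IsGLB s c ↔ (t c ↔ ∀ a ∈ s, t a) := by
  obtain ⟨e, he⟩ := ht.exists_top
  simp only [IsGLB, IsGreatest, mem_lowerBounds, mem_upperBounds, ht.le_iff]
  constructor
  · rintro ⟨h, h'⟩
    exact ⟨fun hc a ha => h a ha hc, fun ha => h' e (fun a h _ => ha a h) he⟩
  · intro h
    exact ⟨fun a ha hc => h.1 hc a ha, fun b hb htb => h.2 fun a ha => hb a ha htb⟩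

theorem isLUB_iff {s : Set V} {c : V} : IsLUB s c ↔ (t c ↔ ∃ a ∈ s, t a) := by
  obtain ⟨z, hz⟩ := ht.exists_bot
  simp only [IsLUB, IsLeast, mem_lowerBounds, mem_upperBounds, ht.le_iff]
  constructor
  · rintro ⟨h, h'⟩
    refine ⟨fun hc => ?_, fun ⟨a, ha, hta⟩ => h a ha hta⟩
    by_contra hn
    exact hz (h' z (fun a ha hta => (hn ⟨a, ha, hta⟩).elim) hc)
  · intro h
    refine ⟨fun a ha hta => h.2 ⟨a, ha, hta⟩, fun b hb htc => ?_⟩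
    obtain ⟨a, ha, hta⟩ := h.1 htc
    exact hb a ha hta

theorem complementary_iff {c d : V} : Complementary c d ↔ (t d ↔ ¬ t c) := by
  obtain ⟨e, he⟩ := ht.exists_top
  obtain ⟨z, hz⟩ := ht.exists_bot
  simp only [Complementary, ht.isBot_iff, ht.isTop_iff, ht.le_iff]
  constructor
  · rintro ⟨h, h'⟩
    refine ⟨fun hd hc => h e (fun _ => hc) (fun _ => hd) he, fun hc => ?_⟩
    by_contra hd
    exact hz (h' z (fun h => (hc h).elim) fun h => (hd h).elim)
  · intro h
    exact ⟨fun x hc hd hx => h.1 (hd hx) (hc hx), fun x hc hd => by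
      by_cases h' : t c
      · exact hc h'
      · exact hd (h.2 h')⟩

theorem exists_iff (p : Prop) : ∃ c, t c ↔ p := by
  obtain ⟨e, he⟩ := ht.exists_top
  obtain ⟨z, hz⟩ := ht.exists_bot
  by_cases hp : p
  · exact ⟨e, by simp [he, hp]⟩
  · exact ⟨z, by simp [hz, hp]⟩

theorem isCCBooleanLattice : IsCCBooleanLattice V where
  exists_isGLB s _ := by simp only [ht.isGLB_iff]; exact ht.exists_iff _
  exists_isLUB s _ := by simp only [ht.isLUB_iff]; exact ht.exists_iff _
  distrib a b c m j hm hj hmb haj := by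
    rw [ht.isGLB_iff] at hm
    rw [ht.isLUB_iff] at hj
    rw [ht.le_iff] at *
    intro ha
    obtain ⟨x, rfl | rfl, hx⟩ := hj.1 (haj ha)
    · exact hx
    · exact hmb (hm.2 (by rintro y (rfl | rfl) <;> assumption))
  exists_compl c := by simp only [ht.complementary_iff]; exact ht.exists_iff _

theorem isPart {ι : Z0Form N → V} (hι : ∀ a, t (ι a) ↔ a.Holds) : IsPart Z0 ι where
  le_iff a b := by rw [Z0.iff_holds, ht.le_iff, hι, hι]
  isBot z hz := by
    rw [ht.isBot_iff, hι]
    exact fun h => Z0.iff_holds.1 (hz .fls) h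
  isTop e he := by
    rw [ht.isTop_iff, hι]
    exact Z0.iff_holds.1 (he .tru) trivial

theorem isMinimalOver {ι : Z0Form N → V} (hι : ∀ a, t (ι a) ↔ a.Holds) : IsMinimalOver Z0 ι where
  lattice := ht.isCCBooleanLattice
  part := ht.isPart hι
  minimal V₀ hV₀ _ hglb _ := by
    refine Set.eq_univ_of_forall fun v => ?_
    obtain ⟨a, ha⟩ : ∃ a : Z0Form N, t v ↔ t (ι a) := by
      by_cases hv : t v
      · exact ⟨.tru, by simp [hv, hι, Z0Form.Holds]⟩
      · exact ⟨.fls, by simp [hv, hι, Z0Form.Holds]⟩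
    -- `V₀` is not assumed closed under equivalence, but an element equivalent to `ι a` is a meet of
    -- `{ι a}`.
    exact hglb {ι a} v (by simpa using hV₀ a) (Set.countable_singleton _)
      (ht.isGLB_iff.2 (by simpa using ha))

end TwoValued

/-- `Z₀` is, up to equivalence, the two-valued lattice; hence so is each minimal lattice over it. -/
theorem IsMinimalOver.twoValued {V : Type*} [Preorder V] {ι : Z0Form N → V}
    (h : IsMinimalOver Z0 ι) : TwoValued (IsTop : V → Prop) ∧ ∀ a, IsTop (ι a) ↔ a.Holds := by
  have hbot : IsBot (ι .fls) := h.part.isBot _ fun a => .t2_fls a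
  have htop : IsTop (ι .tru) := h.part.isTop _ fun a => .t2_tru a
  -- Zero and unit are distinct because `Z0` is consistent.
  have hne : ¬ IsTop (ι .fls) := fun hf =>
    Z0.iff_holds.1 ((h.part.le_iff .tru .fls).2 (hf _)) trivial
  have hex : ∀ v, IsBot v → ¬ IsTop v := fun v hb ht => hne (ht.mono (hb _))
  -- The zeros and units contain the image of `Z0` and are closed under the lattice operations, so
  -- minimality leaves nothing else.
  have hall : {v : V | IsBot v ∨ IsTop v} = Set.univ := by
    refine h.minimal _ (fun a => ?_) (fun a c ha hc => ?_) (fun s c hs _ hc => ?_)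
      fun s c hs _ hc => ?_
    · by_cases ha : a.Holds
      · exact Or.inr (htop.mono ((h.part.le_iff _ _).1 (.t1 fun _ => ha)))
      · exact Or.inl (hbot.mono ((h.part.le_iff _ _).1 (.t1 fun h => ha h)))
    · rcases ha with ha | ha
      · exact Or.inr (hc.2 c (ha c) le_rfl)
      · exact Or.inl (hc.1 c (ha c) le_rfl)
    · by_cases hall : ∀ a ∈ s, IsTop a
      · exact Or.inr (htop.mono (hc.2 fun a ha => hall a ha _))
      · push Not at hall
        obtain ⟨a, ha, hna⟩ := hall
        exact Or.inl (((hs ha).resolve_right hna).mono (hc.1 ha))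
    · by_cases hall : ∀ a ∈ s, IsBot a
      · exact Or.inl (hbot.mono (hc.2 fun a ha => hall a ha _))
      · push Not at hall
        obtain ⟨a, ha, hna⟩ := hall
        exact Or.inr (((hs ha).resolve_left hna).mono (hc.1 ha))
  have hor : ∀ v : V, IsBot v ∨ IsTop v := fun v => hall.ge (Set.mem_univ v)
  refine ⟨⟨fun a b => ⟨fun hab ha => ha.mono hab, fun hab => ?_⟩, ⟨_, htop⟩, ⟨_, hne⟩⟩, fun a => ?_⟩
  · rcases hor a with ha | ha
    · exact ha b
    · exact hab ha a
  · refine ⟨fun ha => Z0.iff_holds.1 ((h.part.le_iff .tru a).2 (ha _)) trivial, fun ha =>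
      htop.mono ((h.part.le_iff _ _).1 (.t1 fun _ => ha))⟩

/-! ### The free lattice and the embedding of `K0'` -/

theorem TwoValued.exists_hom {V V' : Type*} [Preorder V] [Preorder V'] {t : V → Prop}
    {t' : V' → Prop} (ht : TwoValued t) (ht' : TwoValued t') {ι : Z0Form N → V}
    {ι' : Z0Form N → V'} (hι : ∀ a, t (ι a) ↔ a.Holds) (hι' : ∀ a, t' (ι' a) ↔ a.Holds) :
    ∃ φ : V → V', IsHomOnto ι ι' φ := by
  -- Any map preserving truth values works, since order, meets, joins and complements are all
  -- determined by them.
  choose φ hφ using fun v => ht'.exists_iff (t v)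
  refine ⟨φ, ?_, ?_, ?_, ?_, ?_, ?_⟩
  · intro a b; rw [ht.le_iff, ht'.le_iff, hφ, hφ]; exact id
  · intro a b; rw [ht.complementary_iff, ht'.complementary_iff, hφ, hφ]; exact id
  · intro s c _; rw [ht.isGLB_iff, ht'.isGLB_iff, Set.forall_mem_image]; simp only [hφ]; exact id
  · intro s c _; rw [ht.isLUB_iff, ht'.isLUB_iff, Set.exists_mem_image]; simp only [hφ]; exact id
  · intro a; rw [ht'.le_iff, ht'.le_iff, hφ, hι, hι']; exact ⟨id, id⟩
  · intro v'
    obtain ⟨v, hv⟩ := ht.exists_iff (t' v')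
    refine ⟨v, ?_⟩
    rw [ht'.le_iff, ht'.le_iff, hφ, hv]; exact ⟨id, id⟩

theorem TwoValued.prop : TwoValued (ULift.down : ULift.{u} Prop → Prop) where
  le_iff _ _ := Iff.rfl
  exists_top := ⟨⟨True⟩, trivial⟩
  exists_bot := ⟨⟨False⟩, id⟩

theorem isFreeOver_prop :
    IsFreeOver Z0 (fun a : Z0Form N => (⟨a.Holds⟩ : ULift.{u} Prop)) where
  minimalOver := TwoValued.prop.isMinimalOver fun _ => Iff.rfl
  hom _ _ _ h := TwoValued.prop.exists_hom h.twoValued.1 (fun _ => Iff.rfl) h.twoValued.2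

/-- A formula goes to an element with its truth value. Exactness on theorems is soundness and
completeness of `K0'`; the other clauses are the truth conditions of the connectives and
quantifiers. -/
theorem TwoValued.exists_isIsoInto {V : Type*} [Preorder V] {t : V → Prop} (ht : TwoValued t)
    {ι : Z0Form N → V} (hι : ∀ a, t (ι a) ↔ a.Holds) : ∃ f : Form N → V, IsIsoInto ι f := by
  choose f hf using fun a : Form N => ht.exists_iff (IsTrue a)
  refine ⟨f, ?_, ?_, ?_, ?_, ?_, ?_, ?_⟩
  · intro a b ha hb; rw [K0'.iff_isTrue ha hb, ht.le_iff, hf, hf]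
  · intro a; rw [ht.le_iff, ht.le_iff, hf, hι, IsTrue.toForm_iff]; exact ⟨id, id⟩
  · intro a b _ _; rw [ht.isGLB_iff]; simp [hf, IsTrue.and_iff]
  · intro a b _ _; rw [ht.isLUB_iff]; simp [hf, IsTrue.or_iff]
  · intro a _; rw [ht.complementary_iff, hf, hf, IsTrue.not_iff]
  · intro i b _; rw [ht.isGLB_iff, hf, IsTrue.all_iff, Set.forall_mem_range]; simp only [hf]
  · intro i b _; rw [ht.isLUB_iff, hf, IsTrue.ex_iff, Set.exists_range_iff]; simp only [hf]

end Ramified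

theorem mainTheorem10 (N : Ramified.NumRel) :
    -- `Z₀` is consistent
    ¬ Ramified.Z0 (N := N) .tru .fls ∧
    -- `K₀'` is the part of `K₀` without free variables, and contains `Z₀` as a part
    (∀ a b : Ramified.Form N, Ramified.IsSentence a → Ramified.IsSentence b →
      (Ramified.K0' a b ↔ Ramified.K0 a b)) ∧
    (∀ a b : Ramified.Z0Form N, Ramified.Z0 a b ↔ Ramified.K0' a.toForm b.toForm) ∧
    -- the free countably complete boolean lattice over `Z₀` exists
    (∃ (V : Type u) (_ : Preorder V) (ι : Ramified.Z0Form N → V),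
      Ramified.IsFreeOver Ramified.Z0 ι) ∧
    -- `K₀'` is contained isomorphically in it
    (∀ (V : Type u) [Preorder V] (ι : Ramified.Z0Form N → V),
      Ramified.IsFreeOver Ramified.Z0 ι → ∃ f : Ramified.Form N → V, Ramified.IsIsoInto ι f) ∧
    -- `K₀'` and `K₀` are consistent
    ¬ Ramified.K0' (N := N) .tru .fls ∧
    ¬ Ramified.K0 (N := N) .tru .fls ∧
    -- over each system of ramified types, all steps of the iterated extension are consistent, and
    -- so is the ramified type logic that comprises all of them
    ∀ S : Set Ramified.Ty, Ramified.IsTypeSystem S →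
      (∀ n : ℕ, ¬ Ramified.ZStage (N := N) S n .tru .fls ∧
        ¬ Ramified.KStage (N := N) S (n + 1) .tru .fls) ∧
      ¬ Ramified.K (N := N) S .tru .fls := by
  open Ramified in
  have hK : ¬ K0 (N := N) .tru .fls := Thm.consistent _ _
  exact ⟨fun h => Z0.iff_holds.1 h trivial,
    -- A derivation in `K0` may pass through free variables; it is not transformed but replaced, by
    -- way of truth, with a new derivation in `K0'`.
    fun a b ha hb => ⟨K0'.toK0, fun h => K0'.of_isTrue ha hb (h.isTrue ha hb)⟩,
    fun a b => by
      rw [Z0.iff_holds, K0'.iff_isTrue (.toForm a) (.toForm b), IsTrue.toForm_iff,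
        IsTrue.toForm_iff],
    ⟨ULift Prop, inferInstance, _, isFreeOver_prop⟩,
    fun V _ ι h => h.minimalOver.twoValued.1.exists_isIsoInto h.minimalOver.twoValued.2,
    fun h => hK h.toK0, hK,
    fun S _ => ⟨fun n => ⟨Thm.consistent _ _, Thm.consistent _ _⟩, Thm.consistent _ _⟩⟩
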